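/- Let $n\ge 3$ and $1\le i\le n-2$ be integers and let $k=\lceil n/(n-i)\rceil$. Then there exist $i$-dimensional linear subspaces $H_1,\dots,H_k$ of Euclidean space $\mathbb{R}^n$ for which all of the following four statements hold. (i) $H_1^{\perp}+\cdots+H_k^{\perp}=\mathbb{R}^n$, and the set $\{H_1^{\perp},\dots,H_k^{\perp}\}$ cannot be partitioned into two mutually orthogonal nonempty subsets. (ii) If $E\subset S^{n-1}$ is nonempty and closed, and $S^{n-1}\cap (H_j^{\perp}+x)\subset E$ for each $j=1,\dots,k$ and each $x\in E$, then $E=S^{n-1}$. (iii) If $F\subset\mathbb{R}^n$ is closed and, for each $j=1,\dots,k$, invariant under every rotation in $SO(n)$ that acts as the identity on $H_j$, then $F$ is a union of spheres with center at the origin $o$. (iv) If $K\subset\mathbb{R}^n$ is a convex body (a compact convex set with nonempty interior) that is rotationally symmetric with respect to $H_j$ for each $j=1,\dots,k$, then $K$ is a ball with center at $o$ and positive radius. Here a set $X\subset\mathbb{R}^n$ is called rotationally symmetric with respect to a subspace $H$ if, for every $x\in H$, the section $X\cap(H^{\perp}+x)$ is a union of spheres of the affine subspace $H^{\perp}+x$,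 each with center at $x$. Unions of spheres may be empty, and a single point counts as the sphere of radius $0$ centered at it. -/

import Mathlib

namespace RotSym

/-- The translate `Hᗮ + x` of the orthogonal complement of `H`. -/
def orthTranslate {n : ℕ} (H : Submodule ℝ (EuclideanSpace ℝ (Fin n)))
    (x : EuclideanSpace ℝ (Fin n)) : Set (EuclideanSpace ℝ (Fin n)) :=
  {y | y - x ∈ Hᗮ}

/-- `φ` belongs to `SO(n)_H`: it is an element of `SO(n)` (a linear isometry of determinant one)
that acts as the identity on `H`. -/
def IsRotationFixing {n : ℕ} (H : Submodule ℝ (EuclideanSpace ℝ (Fin n)))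
    (φ : EuclideanSpace ℝ (Fin n) ≃ₗᵢ[ℝ] EuclideanSpace ℝ (Fin n)) : Prop :=
  LinearMap.det (φ.toLinearEquiv : EuclideanSpace ℝ (Fin n) →ₗ[ℝ] EuclideanSpace ℝ (Fin n)) = 1 ∧
    ∀ x ∈ H, φ x = x

/-- `X` is rotationally symmetric with respect to `H`: for every `x ∈ H`, the section
`X ∩ (Hᗮ + x)` is a union of spheres of the affine subspace `Hᗮ + x`, each with center `x`
(a single point is the sphere of radius `0`). -/
def IsRotationallySymmetric {n : ℕ} (H : Submodule ℝ (EuclideanSpace ℝ (Fin n)))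
    (X : Set (EuclideanSpace ℝ (Fin n))) : Prop :=
  ∀ x ∈ H, ∃ R : Set ℝ, (∀ r ∈ R, 0 ≤ r) ∧
    X ∩ orthTranslate H x = ⋃ r ∈ R, orthTranslate H x ∩ Metric.sphere x r

/-- `F` is a union of spheres with center at the origin (`{0}` is the sphere of radius `0`). -/
def IsUnionOfCenteredSpheres {n : ℕ} (F : Set (EuclideanSpace ℝ (Fin n))) : Prop :=
  ∃ R : Set ℝ, (∀ r ∈ R, 0 ≤ r) ∧
    F = ⋃ r ∈ R, Metric.sphere (0 : EuclideanSpace ℝ (Fin n)) r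

/-- The orthogonal complements of the `H j` span the whole space, and the set of these orthogonal
complements cannot be partitioned into two mutually orthogonal nonempty subsets. -/
def SpanAndIndecomposable {n k : ℕ}
    (H : Fin k → Submodule ℝ (EuclideanSpace ℝ (Fin n))) : Prop :=
  (⨆ j, (H j)ᗮ) = ⊤ ∧
    ¬ ∃ A B : Set (Submodule ℝ (EuclideanSpace ℝ (Fin n))),
      A.Nonempty ∧ B.Nonempty ∧ Disjoint A B ∧ A ∪ B = Set.range (fun j => (H j)ᗮ) ∧
        ∀ S ∈ A, ∀ T ∈ B, S ⟂ T

/-- A nonempty closed subset `E` of the unit sphere that contains, with each of its points `x`, the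
whole section of the unit sphere by `(H j)ᗮ + x`, for every `j`, is the whole unit sphere. -/
def SphereRigid {n k : ℕ} (H : Fin k → Submodule ℝ (EuclideanSpace ℝ (Fin n))) : Prop :=
  ∀ E : Set (EuclideanSpace ℝ (Fin n)),
    E ⊆ Metric.sphere (0 : EuclideanSpace ℝ (Fin n)) 1 → E.Nonempty → IsClosed E →
    (∀ j, ∀ x ∈ E,
      Metric.sphere (0 : EuclideanSpace ℝ (Fin n)) 1 ∩ orthTranslate (H j) x ⊆ E) →
    E = Metric.sphere (0 : EuclideanSpace ℝ (Fin n)) 1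

/-- A closed set that is invariant, for each `j`, under every rotation that fixes `H j` pointwise
is a union of spheres with center at the origin. -/
def ClosedSetRigid {n k : ℕ} (H : Fin k → Submodule ℝ (EuclideanSpace ℝ (Fin n))) : Prop :=
  ∀ F : Set (EuclideanSpace ℝ (Fin n)), IsClosed F →
    (∀ j, ∀ φ : EuclideanSpace ℝ (Fin n) ≃ₗᵢ[ℝ] EuclideanSpace ℝ (Fin n),
      IsRotationFixing (H j) φ → φ '' F = F) →
    IsUnionOfCenteredSpheres F

/-- A convex body (compact, convex, with interior points) that is rotationally symmetric with
respect to each `H j` is a ball with center at the origin. -/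
def ConvexBodyRigid {n k : ℕ} (H : Fin k → Submodule ℝ (EuclideanSpace ℝ (Fin n))) : Prop :=
  ∀ K : ConvexBody (EuclideanSpace ℝ (Fin n)),
    (interior (K : Set (EuclideanSpace ℝ (Fin n)))).Nonempty →
    (∀ j, IsRotationallySymmetric (H j) (K : Set (EuclideanSpace ℝ (Fin n)))) →
    ∃ r : ℝ, 0 < r ∧ (K : Set (EuclideanSpace ℝ (Fin n))) = Metric.closedBall 0 r

end RotSym

namespace RotSym

/-! All four statements follow from one property of the complements `V j = (H j)ᗮ`: a closed set
that contains, with each of its points, all points of equal norm in the translate of `V j`, for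
every `j`, is invariant in this sense under the whole space (`SphereInvariant ⊤`).

The `V j` are built one at a time, keeping a subspace `S` under which invariance is already forced.
If `S` has unit vector `e` and `g ⟂ S` is a unit vector, the next space is spanned by `f = cos 1 • e
+ sin 1 • g` and by directions orthogonal to `S` and `g`. The reflections along `e` and `f` compose
to a rotation by 2 radians, whose powers are dense because `π` is irrational; closedness then gives
the full circle in `span {e, g}` (`span_pair`). Invariances sharing a vector merge (`sup`), so `S`
gains `d = n - i` dimensions each time, until it fills the space. -/

open Module Real

variable {E : Type*} [NormedAddCommGroup E] [InnerProductSpace ℝ E]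

/-! ### Invariance along subspaces -/

/-- `F` contains, with each of its points `x`, every point of `V + x` with the same norm. -/
def SphereInvariant (V : Submodule ℝ E) (F : Set E) : Prop :=
  ∀ x ∈ F, ∀ y, y - x ∈ V → ‖y‖ = ‖x‖ → y ∈ F

theorem SphereInvariant.mem_iff {V : Submodule ℝ E} {F : Set E} (h : SphereInvariant V F)
    {x y : E} (hxy : y - x ∈ V) (hn : ‖y‖ = ‖x‖) : x ∈ F ↔ y ∈ F :=
  ⟨fun hx => h x hx y hxy hn, fun hy => h y hy x (by simpa using V.neg_mem hxy) hn.symm⟩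

theorem norm_add_eq_norm_add_iff {z a b : E} (ha : inner ℝ z a = 0) (hb : inner ℝ z b = 0) :
    ‖z + a‖ = ‖z + b‖ ↔ ‖a‖ = ‖b‖ := by
  rw [← sq_eq_sq₀ (norm_nonneg _) (norm_nonneg _), norm_add_sq_real, norm_add_sq_real, ha, hb,
    ← sq_eq_sq₀ (norm_nonneg a) (norm_nonneg b)]
  constructor <;> intro h <;> linarith

/-- Each point can be moved to a normal form `z + ‖a‖ • e`: a motion in `V` turns the `V`-component
onto `e`, and then a motion in `P`, which contains both `e` and `B`, absorbs the `B`-component. -/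
theorem SphereInvariant.sup {V P B : Submodule ℝ E} {F : Set E} {e : E} [FiniteDimensional ℝ E]
    (hV : SphereInvariant V F) (hP : SphereInvariant P F) (heV : e ∈ V) (heP : e ∈ P)
    (he : ‖e‖ = 1) (hBP : B ≤ P) (hBV : B ≤ Vᗮ) : SphereInvariant (V ⊔ B) F := by
  have key : ∀ z ∈ (V ⊔ B)ᗮ, ∀ a ∈ V ⊔ B, z + a ∈ F ↔ z + ‖a‖ • e ∈ F := by
    intro z hz a ha
    have hzV : ∀ w ∈ V ⊔ B, inner ℝ z w = 0 := fun w hw =>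
      Submodule.inner_left_of_mem_orthogonal hw hz
    obtain ⟨v, hv, b, hb, rfl⟩ := Submodule.mem_sup.1 ha
    have hbV : ∀ w ∈ V, inner ℝ b w = 0 := fun w hw =>
      Submodule.inner_left_of_mem_orthogonal hw (hBV hb)
    have hvS : v ∈ V ⊔ B := Submodule.mem_sup_left hv
    have heS : e ∈ V ⊔ B := Submodule.mem_sup_left heV
    have hbS : b ∈ V ⊔ B := Submodule.mem_sup_right hb
    have h1 : ‖b + ‖v‖ • e‖ = ‖b + v‖ := by
      refine (norm_add_eq_norm_add_iff (hbV _ (V.smul_mem _ heV)) (hbV _ hv)).2 ?_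
      simp [norm_smul, he]
    refine (hV.mem_iff (y := z + (b + ‖v‖ • e)) ?_ ?_).trans (hP.mem_iff ?_ ?_)
    · have : z + (b + ‖v‖ • e) - (z + (v + b)) = ‖v‖ • e - v := by abel
      rw [this]
      exact V.sub_mem (V.smul_mem _ heV) hv
    · refine (norm_add_eq_norm_add_iff (hzV _ ?_) (hzV _ ha)).2 (by rw [h1, add_comm])
      exact add_mem hbS (Submodule.smul_mem _ _ heS)
    · have : z + ‖v + b‖ • e - (z + (b + ‖v‖ • e)) = ‖v + b‖ • e - (b + ‖v‖ • e) := by abel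
      rw [this]
      exact P.sub_mem (P.smul_mem _ heP) (P.add_mem (hBP hb) (P.smul_mem _ heP))
    · refine (norm_add_eq_norm_add_iff (hzV _ (Submodule.smul_mem _ _ heS)) (hzV _ ?_)).2 ?_
      · exact add_mem hbS (Submodule.smul_mem _ _ heS)
      · rw [h1, norm_smul, he, mul_one, norm_norm, add_comm]
  intro x hx y hyx hn
  obtain ⟨a, ha, z, hz, rfl⟩ := (V ⊔ B).exists_add_mem_mem_orthogonal x
  have hb : y - z ∈ V ⊔ B := by
    have : y - z = y - (a + z) + a := by abel
    rw [this]
    exact add_mem hyx ha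
  have hab : ‖y - z‖ = ‖a‖ := by
    refine (norm_add_eq_norm_add_iff (Submodule.inner_left_of_mem_orthogonal hb hz)
      (Submodule.inner_left_of_mem_orthogonal ha hz)).1 ?_
    rw [add_sub_cancel, hn, add_comm]
  rw [← add_sub_cancel z y, key z hz _ hb, hab, ← key z hz a ha, add_comm]
  exact hx

theorem SphereInvariant.span_pair {V W : Submodule ℝ E} {F : Set E} {e g : E}
    [FiniteDimensional ℝ E] (hF : IsClosed F)
    (hV : SphereInvariant V F) (hW : SphereInvariant W F) (he : ‖e‖ = 1) (hg : ‖g‖ = 1)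
    (heg : inner ℝ e g = 0) (heV : e ∈ V) (hfW : cos 1 • e + sin 1 • g ∈ W) :
    SphereInvariant (Submodule.span ℝ {e, g}) F := by
  have hcomb : ∀ a b : ℝ, a • e + b • g ∈ Submodule.span ℝ {e, g} := fun a b =>
    Submodule.mem_span_pair.2 ⟨a, b, rfl⟩
  have hcnorm : ∀ a b : ℝ, ‖a • e + b • g‖ ^ 2 = a ^ 2 + b ^ 2 := by
    intro a b
    rw [norm_add_sq_real]
    simp [norm_smul, he, hg, inner_smul_left, inner_smul_right, heg]
  have polar : ∀ a ∈ Submodule.span ℝ {e, g},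
      ∃ t : ℝ, a = (‖a‖ * cos t) • e + (‖a‖ * sin t) • g := by
    intro a ha
    obtain ⟨p, q, rfl⟩ := Submodule.mem_span_pair.1 ha
    have hn : ‖p • e + q • g‖ = ‖(⟨p, q⟩ : ℂ)‖ := by
      rw [← sq_eq_sq₀ (norm_nonneg _) (norm_nonneg _), hcnorm, ← Complex.normSq_eq_norm_sq,
        Complex.normSq_mk]
      ring
    refine ⟨Complex.arg ⟨p, q⟩, ?_⟩
    rw [hn, Complex.norm_mul_cos_arg, Complex.norm_mul_sin_arg]
  intro x hx y hyx hn
  obtain ⟨a, ha, z, hz, rfl⟩ := (Submodule.span ℝ {e, g}).exists_add_mem_mem_orthogonal x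
  have hb : y - z ∈ Submodule.span ℝ {e, g} := by
    have : y - z = y - (a + z) + a := by abel
    rw [this]
    exact add_mem hyx ha
  have hab : ‖y - z‖ = ‖a‖ := by
    refine (norm_add_eq_norm_add_iff (Submodule.inner_left_of_mem_orthogonal hb hz)
      (Submodule.inner_left_of_mem_orthogonal ha hz)).1 ?_
    rw [add_sub_cancel, hn, add_comm]
  obtain ⟨s, hs⟩ := polar a ha
  obtain ⟨t, ht⟩ := polar _ hb
  rw [hab] at ht
  set r := ‖a‖
  let γ : ℝ → E := fun θ => z + ((r * cos θ) • e + (r * sin θ) • g)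
  have hγs : γ s ∈ F := by simpa only [γ, ← hs, add_comm z a] using hx
  have hγnorm : ∀ θ θ', ‖γ θ‖ = ‖γ θ'‖ := by
    intro θ θ'
    refine (norm_add_eq_norm_add_iff (Submodule.inner_left_of_mem_orthogonal (hcomb _ _) hz)
      (Submodule.inner_left_of_mem_orthogonal (hcomb _ _) hz)).2 ?_
    rw [← sq_eq_sq₀ (norm_nonneg _) (norm_nonneg _), hcnorm, hcnorm]
    nlinarith [sin_sq_add_cos_sq θ, sin_sq_add_cos_sq θ']
  -- On the circle, the reflection along `e` is `θ ↦ π - θ` and the one along `f`, at angle 1, is `θ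
  -- ↦ π + 2 - θ`; together they shift `θ` by 2.
  have refl_e : ∀ θ, γ θ ∈ F ↔ γ (π - θ) ∈ F := by
    intro θ
    refine hV.mem_iff ?_ (hγnorm _ _)
    have : γ (π - θ) - γ θ = (-2 * r * cos θ) • e := by
      simp only [γ, cos_pi_sub, sin_pi_sub]
      module
    rw [this]
    exact V.smul_mem _ heV
  have refl_f : ∀ θ, γ θ ∈ F ↔ γ (π - (θ - 2)) ∈ F := by
    intro θ
    refine hW.mem_iff ?_ (hγnorm _ _)
    have : γ (π - (θ - 2)) - γ θ =
        (-2 * r * cos (θ - 1)) • (cos 1 • e + sin 1 • g) := by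
      have h1 : cos (θ - 2) + cos θ = 2 * cos (θ - 1) * cos 1 := by
        rw [cos_add_cos, show (θ - 2 + θ) / 2 = θ - 1 by ring, show (θ - 2 - θ) / 2 = -1 by ring,
          cos_neg]
      have h2 : sin θ - sin (θ - 2) = 2 * cos (θ - 1) * sin 1 := by
        rw [sin_sub_sin, show (θ + (θ - 2)) / 2 = θ - 1 by ring,
          show (θ - (θ - 2)) / 2 = 1 by ring]
        ring
      have h1' : cos (θ - 2) = 2 * cos (θ - 1) * cos 1 - cos θ := by linarith
      have h2' : sin (θ - 2) = sin θ - 2 * cos (θ - 1) * sin 1 := by linarith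
      simp only [γ, cos_pi_sub, sin_pi_sub, h1', h2']
      module
    rw [this]
    exact W.smul_mem _ hfW
  have hclosed : IsClosed {θ | γ (s + θ) ∈ F} := hF.preimage (by fun_prop)
  have hdense : Dense (AddSubgroup.closure {2, 2 * π} : Set ℝ) := by
    rw [dense_addSubgroupClosure_pair_iff, ← irrational_inv_iff]
    have : (2 / (2 * π))⁻¹ = π := by
      field_simp
    rw [this]
    exact irrational_pi
  have htrans : ∀ c ∈ AddSubgroup.closure {2, 2 * π}, ∀ θ, γ θ ∈ F ↔ γ (θ + c) ∈ F := by
    intro c hc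
    induction hc using AddSubgroup.closure_induction with
    | mem c hc =>
      intro θ
      rcases hc with rfl | rfl
      · rw [refl_e θ, refl_f]
        ring_nf
      · simp only [γ, cos_add_two_pi, sin_add_two_pi]
    | zero => simp
    | add c c' _ _ h h' =>
      intro θ
      rw [h θ, h' (θ + c), add_assoc]
    | neg c _ h =>
      intro θ
      rw [h (θ + -c), neg_add_cancel_right]
  have hall : {θ | γ (s + θ) ∈ F} = Set.univ := by
    rw [← hclosed.closure_eq]
    exact (hdense.mono fun c hc => (htrans c hc s).1 hγs).closure_eq
  have hγt : γ (s + (t - s)) ∈ F := by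
    have : t - s ∈ {θ | γ (s + θ) ∈ F} := hall ▸ Set.mem_univ _
    exact this
  rw [add_sub_cancel] at hγt
  simpa only [γ, ← ht, add_sub_cancel] using hγt

/-! ### Construction of the subspaces -/

theorem exists_submodule_le_finrank_eq [FiniteDimensional ℝ E] (W : Submodule ℝ E) {m : ℕ}
    (hm : m ≤ finrank ℝ W) : ∃ C ≤ W, finrank ℝ C = m := by
  obtain ⟨f, hf⟩ := exists_linearIndependent_of_le_finrank hm
  refine ⟨Submodule.span ℝ (Set.range fun j => (f j : E)), ?_, ?_⟩
  · rw [Submodule.span_le]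
    rintro _ ⟨j, rfl⟩
    exact (f j).2
  · exact (finrank_span_eq_card (hf.map' W.subtype W.ker_subtype)).trans (Fintype.card_fin m)

theorem exists_unit_mem [FiniteDimensional ℝ E] (W : Submodule ℝ E) (hW : 0 < finrank ℝ W) :
    ∃ e ∈ W, ‖e‖ = 1 := by
  obtain ⟨x, hx⟩ := finrank_pos_iff_exists_ne_zero.1 hW
  have hx' : (x : E) ≠ 0 := by simpa using hx
  exact ⟨‖(x : E)‖⁻¹ • (x : E), W.smul_mem _ x.2, by
    rw [norm_smul, norm_inv, norm_norm, inv_mul_cancel₀ (norm_ne_zero_iff.2 hx')]⟩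

theorem finrank_sup_of_isOrtho [FiniteDimensional ℝ E] {U W : Submodule ℝ E} (h : U ⟂ W) :
    finrank ℝ (U ⊔ W : Submodule ℝ E) = finrank ℝ U + finrank ℝ W := by
  have := Submodule.finrank_sup_add_finrank_inf_eq U W
  rwa [h.disjoint.eq_bot, finrank_bot, add_zero] at this

theorem exists_sphereInvariant_extension [FiniteDimensional ℝ E] {d : ℕ} (hd : 1 ≤ d)
    (hdE : d ≤ finrank ℝ E) (S : Submodule ℝ E) (hS : d ≤ finrank ℝ S) :
    ∃ V S' : Submodule ℝ E, finrank ℝ V = d ∧ min (finrank ℝ E) (finrank ℝ S + d) ≤ finrank ℝ S' ∧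
      ∀ F : Set E, IsClosed F → SphereInvariant S F → SphereInvariant V F →
        SphereInvariant S' F := by
  have hSS := S.finrank_add_finrank_orthogonal
  obtain hle | hlt := le_or_gt d (finrank ℝ Sᗮ)
  · obtain ⟨e, heS, he⟩ := exists_unit_mem S (by omega)
    obtain ⟨C, hCS, hC⟩ := exists_submodule_le_finrank_eq Sᗮ hle
    obtain ⟨g, hgC, hg⟩ := exists_unit_mem C (by omega)
    obtain ⟨D, hDC, hD⟩ : ∃ D ≤ C, finrank ℝ D = d - 1 ∧ D ≤ (Submodule.span ℝ {g})ᗮ ∧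
        Submodule.span ℝ {g} ⊔ D = C := by
      have hgle : Submodule.span ℝ {g} ≤ C := (Submodule.span_singleton_le_iff_mem _ _).2 hgC
      refine ⟨(Submodule.span ℝ {g})ᗮ ⊓ C, inf_le_right, ?_, inf_le_left,
        Submodule.sup_orthogonal_inf_of_hasOrthogonalProjection hgle⟩
      have h := Submodule.finrank_add_inf_finrank_orthogonal hgle
      rw [finrank_span_singleton (by rintro rfl; simp at hg), hC] at h
      omega
    obtain ⟨hD, hDg, hgD⟩ := hD
    have heg : inner ℝ e g = 0 := Submodule.inner_right_of_mem_orthogonal heS (hCS hgC)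
    set f := cos 1 • e + sin 1 • g with hf
    have hfn : ‖f‖ = 1 := by
      rw [← sq_eq_sq₀ (norm_nonneg _) zero_le_one, hf, norm_add_sq_real]
      simp [norm_smul, he, hg, inner_smul_left, inner_smul_right, heg]
    have hgS : Submodule.span ℝ {g} ≤ Sᗮ := (Submodule.span_singleton_le_iff_mem _ _).2 (hCS hgC)
    have hSgD : D ≤ (S ⊔ Submodule.span ℝ {g})ᗮ := by
      rw [← Submodule.inf_orthogonal]
      exact le_inf (hDC.trans hCS) hDg
    have hfSg : f ∈ S ⊔ Submodule.span ℝ {g} :=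
      add_mem (Submodule.smul_mem _ _ (Submodule.mem_sup_left heS))
        (Submodule.smul_mem _ _ (Submodule.mem_sup_right (Submodule.mem_span_singleton_self g)))
    refine ⟨Submodule.span ℝ {f} ⊔ D, S ⊔ Submodule.span ℝ {g} ⊔ D, ?_, ?_, ?_⟩
    · rw [finrank_sup_of_isOrtho, finrank_span_singleton (by intro h; simp [h] at hfn), hD]
      · omega
      · exact Submodule.IsOrtho.symm (hSgD.trans (Submodule.orthogonal_le
          ((Submodule.span_singleton_le_iff_mem _ _).2 hfSg)))
    · rw [sup_assoc, hgD, finrank_sup_of_isOrtho, hC]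
      · exact min_le_right _ _
      · exact Submodule.IsOrtho.symm hCS
    · intro F hF hSF hVF
      have hfV : f ∈ Submodule.span ℝ {f} ⊔ D :=
        Submodule.mem_sup_left (Submodule.mem_span_singleton_self f)
      have h1 := hSF.span_pair hF hVF he hg heg heS hfV
      have h2 := hSF.sup (B := Submodule.span ℝ {g}) h1 heS
        (Submodule.subset_span (by simp)) he (Submodule.span_mono (by simp)) hgS
      exact h2.sup hVF hfSg hfV hfn le_sup_right hSgD
  -- Fewer than `d` dimensions are missing: the new space takes all of `Sᗮ` and is padded inside
  -- `S`. The padding is nonzero, which supplies the shared vector for `sup`.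
  · obtain ⟨A, hAS, hA⟩ := exists_submodule_le_finrank_eq S (m := d - finrank ℝ Sᗮ) (by omega)
    obtain ⟨e, heA, he⟩ := exists_unit_mem A (by omega)
    refine ⟨A ⊔ Sᗮ, S ⊔ Sᗮ, ?_, ?_, ?_⟩
    · rw [finrank_sup_of_isOrtho (Submodule.isOrtho_iff_le.2
        (hAS.trans S.le_orthogonal_orthogonal)), hA]
      omega
    · rw [Submodule.sup_orthogonal_of_hasOrthogonalProjection, finrank_top]
      exact min_le_left _ _
    · intro F _ hSF hVF
      exact hSF.sup hVF (hAS heA) (Submodule.mem_sup_left heA) he le_sup_right le_rfl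

theorem exists_sphereInvariant_chain [FiniteDimensional ℝ E] {d : ℕ} (hd : 1 ≤ d)
    (hdE : d ≤ finrank ℝ E) (t : ℕ) :
    ∃ (V : Fin (t + 1) → Submodule ℝ E) (S : Submodule ℝ E), (∀ j, finrank ℝ (V j) = d) ∧
      min (finrank ℝ E) ((t + 1) * d) ≤ finrank ℝ S ∧
      ∀ F : Set E, IsClosed F → (∀ j, SphereInvariant (V j) F) → SphereInvariant S F := by
  induction t with
  | zero =>
    obtain ⟨V, -, hV⟩ := exists_submodule_le_finrank_eq (⊤ : Submodule ℝ E) (m := d)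
      (by rwa [finrank_top])
    exact ⟨fun _ => V, V, fun _ => hV, by simp [hV], fun F _ h => h 0⟩
  | succ t ih =>
    obtain ⟨V, S, hV, hS, hVS⟩ := ih
    have h1 : d ≤ (t + 1) * d := Nat.le_mul_of_pos_left _ t.succ_pos
    obtain ⟨W, S', hW, hS', hWS⟩ := exists_sphereInvariant_extension hd hdE S
      ((le_min hdE h1).trans hS)
    obtain ⟨V', hV', hW'⟩ : ∃ V' : Fin (t + 1 + 1) → Submodule ℝ E,
        (∀ j : Fin (t + 1), V' j.castSucc = V j) ∧ V' (Fin.last _) = W :=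
      ⟨Fin.snoc (α := fun _ => Submodule ℝ E) V W, fun j => Fin.snoc_castSucc _ _ j,
        Fin.snoc_last _ _⟩
    refine ⟨V', S', ?_, ?_, ?_⟩
    · intro j
      refine Fin.lastCases ?_ (fun j => ?_) j
      · rwa [hW']
      · rw [hV', hV j]
    · rw [add_one_mul (t + 1) d]
      omega
    · intro F hF h
      refine hWS F hF (hVS F hF fun j => ?_) ?_
      · exact hV' j ▸ h j.castSucc
      · exact hW' ▸ h (Fin.last _)

theorem exists_sphereInvariant_family [FiniteDimensional ℝ E] {d k : ℕ} (hd : 1 ≤ d)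
    (hdE : d ≤ finrank ℝ E) (hk : finrank ℝ E ≤ k * d) :
    ∃ V : Fin k → Submodule ℝ E, (∀ j, finrank ℝ (V j) = d) ∧
      ∀ F : Set E, IsClosed F → (∀ j, SphereInvariant (V j) F) → SphereInvariant ⊤ F := by
  obtain _ | t := k
  · omega
  obtain ⟨V, S, hV, hS, h⟩ := exists_sphereInvariant_chain hd hdE t
  rw [min_eq_left hk] at hS
  rw [← Submodule.eq_top_of_finrank_eq (le_antisymm S.finrank_le hS)]
  exact ⟨V, hV, h⟩

theorem SphereInvariant.eq_top_of_submodule {S : Submodule ℝ E}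
    (h : SphereInvariant ⊤ (S : Set E)) {e : E} (he : e ∈ S) (he0 : e ≠ 0) : S = ⊤ := by
  refine (Submodule.eq_top_iff' (p := S)).2 fun y => ?_
  obtain rfl | hy := eq_or_ne y 0
  · exact S.zero_mem
  have hy' := norm_ne_zero_iff.2 hy
  have he' := norm_ne_zero_iff.2 he0
  have h1 : (‖e‖ / ‖y‖) • y ∈ S := by
    refine h e he _ trivial ?_
    rw [norm_smul, norm_div, norm_norm, norm_norm, div_mul_cancel₀ _ hy']
  exact (S.smul_mem_iff (div_ne_zero he' hy')).1 h1

theorem sphereInvariant_of_le {V S : Submodule ℝ E} (h : V ≤ S) :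
    SphereInvariant V (S : Set E) := fun x hx y hy _ => by
  simpa using S.add_mem (h hy) hx

theorem sphereInvariant_of_isOrtho {V S : Submodule ℝ E} (h : S ⟂ V) :
    SphereInvariant V (S : Set E) := fun x hx y hy hn => by
  have h0 : inner ℝ x (y - x) = 0 := h.inner_eq hx hy
  have h1 : ‖x + (y - x)‖ ^ 2 = ‖x‖ ^ 2 + ‖y - x‖ ^ 2 := by
    rw [norm_add_sq_real, h0]
    ring
  rw [add_sub_cancel, hn] at h1
  have h2 : y - x = 0 := by
    rw [← norm_eq_zero, ← sq_eq_zero_iff]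
    linarith
  rwa [sub_eq_zero.1 h2]

/-! ### The four consequences -/

section Euclidean

variable {n k : ℕ}

/-- Rigidity is tested on linear subspaces: a nonzero one that is invariant under `⊤` is everything.
The sum of the complements is invariant, and so is the sum of one block of an orthogonal partition,
since sections orthogonal to it are single points. -/
theorem spanAndIndecomposable_of_rigid
    {H : Fin k → Submodule ℝ (EuclideanSpace ℝ (Fin n))} (hk : 0 < k)
    (hH : ∀ j, (H j)ᗮ ≠ ⊥)
    (h : ∀ F : Set (EuclideanSpace ℝ (Fin n)), IsClosed F →
      (∀ j, SphereInvariant (H j)ᗮ F) → SphereInvariant ⊤ F) :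
    SpanAndIndecomposable H := by
  constructor
  · obtain ⟨e, he, he0⟩ := (Submodule.ne_bot_iff _).1 (hH ⟨0, hk⟩)
    exact (h _ (Submodule.closed_of_finiteDimensional _) fun j =>
      sphereInvariant_of_le (le_iSup (fun j => (H j)ᗮ) j)).eq_top_of_submodule
        (le_iSup (fun j => (H j)ᗮ) _ he) he0
  · rintro ⟨A, B, ⟨U, hU⟩, ⟨W, hW⟩, -, hAB, hort⟩
    obtain ⟨i, rfl⟩ : U ∈ Set.range fun j => (H j)ᗮ := hAB ▸ Or.inl hU
    obtain ⟨j, rfl⟩ : W ∈ Set.range fun j => (H j)ᗮ := hAB ▸ Or.inr hW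
    obtain ⟨e, he, he0⟩ := (Submodule.ne_bot_iff _).1 (hH i)
    have htop : sSup A = ⊤ := by
      refine (h _ (Submodule.closed_of_finiteDimensional _) fun l => ?_).eq_top_of_submodule
        (le_sSup hU he) he0
      have hl : (H l)ᗮ ∈ A ∪ B := hAB ▸ Set.mem_range_self l
      obtain hl | hl := hl
      · exact sphereInvariant_of_le (le_sSup hl)
      · exact sphereInvariant_of_isOrtho (Submodule.isOrtho_sSup_left.2 fun S hS => hort S hS _ hl)
    have : sSup A ⟂ (H j)ᗮ := Submodule.isOrtho_sSup_left.2 fun S hS => hort S hS _ hW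
    rw [htop, Submodule.isOrtho_top_left] at this
    exact hH j this

theorem sphereRigid_of_rigid {H : Fin k → Submodule ℝ (EuclideanSpace ℝ (Fin n))}
    (h : ∀ F : Set (EuclideanSpace ℝ (Fin n)), IsClosed F →
      (∀ j, SphereInvariant (H j)ᗮ F) → SphereInvariant ⊤ F) :
    SphereRigid H := by
  intro F hFS ⟨x, hx⟩ hF hinv
  refine hFS.antisymm fun y hy => ?_
  have hx1 := mem_sphere_zero_iff_norm.1 (hFS hx)
  refine h F hF (fun j u hu v hv hn => hinv j u hu ⟨?_, hv⟩) x hx y trivial ?_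
  · rw [mem_sphere_zero_iff_norm, hn]
    exact mem_sphere_zero_iff_norm.1 (hFS hu)
  · rw [hx1]
    exact mem_sphere_zero_iff_norm.1 hy

theorem SphereInvariant.isUnionOfCenteredSpheres {F : Set (EuclideanSpace ℝ (Fin n))}
    (h : SphereInvariant ⊤ F) : IsUnionOfCenteredSpheres F := by
  refine ⟨norm '' F, ?_, ?_⟩
  · rintro _ ⟨x, -, rfl⟩
    exact norm_nonneg x
  · ext y
    simp only [Set.mem_iUnion, mem_sphere_zero_iff_norm]
    constructor
    · exact fun hy => ⟨‖y‖, ⟨y, hy, rfl⟩, rfl⟩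
    · rintro ⟨_, ⟨x, hx, rfl⟩, hn⟩
      exact h x hx y trivial hn

theorem sphereInvariant_of_isRotationFixing {H : Submodule ℝ (EuclideanSpace ℝ (Fin n))}
    (hd : 2 ≤ finrank ℝ Hᗮ) {F : Set (EuclideanSpace ℝ (Fin n))}
    (hF : ∀ φ : EuclideanSpace ℝ (Fin n) ≃ₗᵢ[ℝ] EuclideanSpace ℝ (Fin n),
      IsRotationFixing H φ → φ '' F = F) : SphereInvariant Hᗮ F := by
  intro x hx y hyx hn
  obtain rfl | hne := eq_or_ne y x
  · exact hx
  -- The reflection exchanging `x` and `y` has determinant -1. A preceding reflection along `w`,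
  -- which fixes `x` and `H`, corrects the sign; such a `w` exists because `Hᗮ` has dimension at
  -- least 2.
  obtain ⟨w, hwH, hwx, hw0⟩ : ∃ w ∈ Hᗮ, inner ℝ w x = 0 ∧ w ≠ 0 := by
    let L : Hᗮ →ₗ[ℝ] ℝ := (innerₛₗ ℝ x).comp Hᗮ.subtype
    have hL := L.finrank_range_add_finrank_ker
    have hr : finrank ℝ (LinearMap.range L) ≤ 1 := by
      simpa using Submodule.finrank_le (LinearMap.range L)
    obtain ⟨w, hw⟩ := finrank_pos_iff_exists_ne_zero.1
      (show 0 < finrank ℝ (LinearMap.ker L) by omega)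
    refine ⟨w, w.1.2, ?_, by simpa using hw⟩
    rw [real_inner_comm]
    exact w.2
  have hrefl : ∀ u : EuclideanSpace ℝ (Fin n), u ≠ 0 →
      LinearMap.det ((ℝ ∙ u)ᗮ.reflection.toLinearEquiv :
        EuclideanSpace ℝ (Fin n) →ₗ[ℝ] EuclideanSpace ℝ (Fin n)) = -1 := by
    intro u hu
    have := Submodule.det_reflection (ℝ ∙ u)ᗮ
    rw [Submodule.orthogonal_orthogonal, finrank_span_singleton hu, pow_one] at this
    exact this
  have hfix : ∀ u ∈ Hᗮ, ∀ v ∈ H, (ℝ ∙ u)ᗮ.reflection v = v := fun u hu v hv =>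
    Submodule.reflection_mem_subspace_eq_self (Submodule.mem_orthogonal_singleton_iff_inner_right.2
      (Submodule.inner_left_of_mem_orthogonal hv hu))
  have hxy : x - y ∈ Hᗮ := by simpa using Hᗮ.neg_mem hyx
  let φ := (ℝ ∙ w)ᗮ.reflection.trans (ℝ ∙ (x - y))ᗮ.reflection
  have hφ : IsRotationFixing H φ := by
    constructor
    · have : (φ.toLinearEquiv : EuclideanSpace ℝ (Fin n) →ₗ[ℝ] EuclideanSpace ℝ (Fin n)) =
          ((ℝ ∙ (x - y))ᗮ.reflection.toLinearEquiv :
            EuclideanSpace ℝ (Fin n) →ₗ[ℝ] EuclideanSpace ℝ (Fin n)) ∘ₗ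
          ((ℝ ∙ w)ᗮ.reflection.toLinearEquiv :
            EuclideanSpace ℝ (Fin n) →ₗ[ℝ] EuclideanSpace ℝ (Fin n)) := rfl
      rw [this, LinearMap.det_comp, hrefl _ (sub_ne_zero.2 hne.symm), hrefl w hw0]
      norm_num
    · intro v hv
      rw [LinearIsometryEquiv.trans_apply, hfix w hwH v hv, hfix _ hxy v hv]
  have hφx : φ x = y := by
    have : (ℝ ∙ w)ᗮ.reflection x = x := Submodule.reflection_mem_subspace_eq_self
      (Submodule.mem_orthogonal_singleton_iff_inner_right.2 hwx)
    rw [LinearIsometryEquiv.trans_apply, this, Submodule.reflection_sub hn.symm]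
  rw [← hF φ hφ, ← hφx]
  exact Set.mem_image_of_mem φ hx

theorem IsRotationallySymmetric.sphereInvariant {H : Submodule ℝ (EuclideanSpace ℝ (Fin n))}
    {X : Set (EuclideanSpace ℝ (Fin n))} (h : IsRotationallySymmetric H X) :
    SphereInvariant Hᗮ X := by
  intro x hx y hyx hn
  obtain ⟨p, hp, q, hq, rfl⟩ := H.exists_add_mem_mem_orthogonal x
  obtain ⟨R, -, hR⟩ := h p hp
  have hy : y - p ∈ Hᗮ := by
    have : y - p = y - (p + q) + q := by abel
    rw [this]
    exact add_mem hyx hq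
  have hyq : ‖y - p‖ = ‖q‖ := by
    refine (norm_add_eq_norm_add_iff (Submodule.inner_right_of_mem_orthogonal hp hy)
      (Submodule.inner_right_of_mem_orthogonal hp hq)).1 ?_
    rw [add_sub_cancel, hn]
  have hxR : p + q ∈ X ∩ orthTranslate H p := ⟨hx, by simpa [orthTranslate] using hq⟩
  rw [hR] at hxR
  obtain ⟨r, hr, -, hqr⟩ := Set.mem_iUnion₂.1 hxR
  have hyR : y ∈ ⋃ r ∈ R, orthTranslate H p ∩ Metric.sphere p r := by
    refine Set.mem_iUnion₂.2 ⟨r, hr, hy, ?_⟩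
    rw [mem_sphere_iff_norm, hyq]
    simpa using hqr
  rw [← hR] at hyR
  exact hyR.1

/-- A point of maximal norm brings its whole sphere into `K`, and the convex hull of that sphere is
the ball. -/
theorem SphereInvariant.exists_eq_closedBall [Nontrivial E] {K : Set E}
    (hinv : SphereInvariant ⊤ K) (hc : IsCompact K) (hK : Convex ℝ K)
    (hint : (interior K).Nonempty) : ∃ r : ℝ, 0 < r ∧ K = Metric.closedBall 0 r := by
  obtain ⟨x, hx, hmax⟩ := hc.exists_isMaxOn (hint.mono interior_subset) continuous_norm.continuousOn
  have hle : ∀ y ∈ K, ‖y‖ ≤ ‖x‖ := fun y hy => hmax hy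
  have hpos : 0 < ‖x‖ := by
    by_contra! h0
    have hsub : K ⊆ {0} := fun y hy => norm_le_zero_iff.1 ((hle y hy).trans h0)
    have := hint.mono (interior_mono hsub)
    rw [interior_singleton] at this
    exact Set.not_nonempty_empty this
  refine ⟨‖x‖, hpos, Set.Subset.antisymm (fun y hy => mem_closedBall_zero_iff.2 (hle y hy)) ?_⟩
  rw [← convexHull_sphere_eq_closedBall (0 : E) hpos.le]
  refine convexHull_min (fun y hy => ?_) hK
  exact hinv x hx y trivial (mem_sphere_zero_iff_norm.1 hy)

end Euclidean

end RotSym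

theorem mainTheorem7 (n i : ℕ) (hi : 1 ≤ i) (hin : i + 2 ≤ n) :
    ∃ H : Fin ⌈(n : ℝ) / ((n : ℝ) - (i : ℝ))⌉₊ → Submodule ℝ (EuclideanSpace ℝ (Fin n)),
      (∀ j, Module.finrank ℝ (H j) = i) ∧
        RotSym.SpanAndIndecomposable H ∧ RotSym.SphereRigid H ∧
        RotSym.ClosedSetRigid H ∧ RotSym.ConvexBodyRigid H := by
  have hcast : (n : ℝ) - (i : ℝ) = ((n - i : ℕ) : ℝ) := by
    rw [Nat.cast_sub (by omega)]
  have hpos : (0 : ℝ) < ((n - i : ℕ) : ℝ) := by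
    exact_mod_cast (by omega : 0 < n - i)
  set k := ⌈(n : ℝ) / ((n : ℝ) - (i : ℝ))⌉₊ with hk
  -- The only property of the ceiling that the construction needs: `k` steps of `n - i` dimensions
  -- exhaust the space.
  have hkn : n ≤ k * (n - i) := by
    have := Nat.le_ceil ((n : ℝ) / ((n : ℝ) - (i : ℝ)))
    rw [← hk, hcast, div_le_iff₀ hpos] at this
    exact_mod_cast this
  have hk0 : 0 < k := Nat.pos_of_ne_zero fun h => by
    rw [h] at hkn
    omega
  have hn : Module.finrank ℝ (EuclideanSpace ℝ (Fin n)) = n := finrank_euclideanSpace_fin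
  obtain ⟨V, hV, hrigid⟩ := RotSym.exists_sphereInvariant_family
    (E := EuclideanSpace ℝ (Fin n)) (d := n - i) (k := k) (by omega) (by omega) (by rwa [hn])
  have hVV : ∀ j, (V j)ᗮᗮ = V j := fun j => (V j).orthogonal_orthogonal
  have hrigid' : ∀ F : Set (EuclideanSpace ℝ (Fin n)), IsClosed F →
      (∀ j, RotSym.SphereInvariant (V j)ᗮᗮ F) → RotSym.SphereInvariant ⊤ F := by
    simpa only [hVV] using hrigid
  have : NeZero n := ⟨by omega⟩
  refine ⟨fun j => (V j)ᗮ, fun j => ?_, RotSym.spanAndIndecomposable_of_rigid hk0 (fun j h => ?_)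
    hrigid', RotSym.sphereRigid_of_rigid hrigid', fun F hF hinv => ?_, fun K hK hsym => ?_⟩
  · have := (V j).finrank_add_finrank_orthogonal
    rw [hV j, hn] at this
    change Module.finrank ℝ (V j)ᗮ = i
    omega
  · have := hV j
    rw [hVV j] at h
    rw [h, finrank_bot] at this
    omega
  · refine (hrigid' F hF fun j => ?_).isUnionOfCenteredSpheres
    refine RotSym.sphereInvariant_of_isRotationFixing ?_ (hinv j)
    rw [hVV j, hV j]
    omega
  · exact (hrigid' K K.isCompact.isClosed fun j => (hsym j).sphereInvariant).exists_eq_closedBall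
      K.isCompact K.convex hK
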